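/- Let $n\ge 3$ be an integer and let $p$ be a prime number. Let $G$ be a pro-$p$ Demushkin group, i.e. a pro-$p$ group such that $\dim_{\mathbb Z/p}H^1(G,\mathbb Z/p)<\infty$, $\dim_{\mathbb Z/p}H^2(G,\mathbb Z/p)=1$, and the cup product $H^1(G,\mathbb Z/p)\times H^1(G,\mathbb Z/p)\to H^2(G,\mathbb Z/p)$ is a non-degenerate bilinear form (continuous cohomology, trivial action). Then $G$ has the strong vanishing $n$-fold Massey product property with respect to $p$: for all $a_1,\dots,a_n\in H^1(G,\mathbb Z/p)$ with $a_i\cup a_{i+1}=0$ for every $1\le i<n$, the $n$-fold Massey product $\langle a_1,\dots,a_n\rangle\subseteq H^2(G,\mathbb Z/p)$ contains $0$. Here $\langle a_1,\dots,a_n\rangle$ is the set of classes of the $2$-cocycles $\sum_{k=2}^{n}a_{1k}\cup a_{k,n+1}$, for all families of continuous cochains $a_{ij}:G\to\mathbb Z/p$ ($1\le i<j\le n+1$, $(i,j)\ne(1,n+1)$) such that $a_{i,i+1}$ represents $a_i$ and $\delta(a_{ij})=\sum_{i<k<j}a_{ik}\cup a_{kj}$, where $\delta$ is the differential $(\delta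 f)(g,h)=f(h)-f(gh)+f(g)$ and $(f\cup f')(g,h)=f(g)f'(h)$. Moreover, for all such $a_1,\dots,a_n$, viewed as continuous homomorphisms $G\to\mathbb Z/p$, there is a continuous homomorphism $\psi:G\to U_{n+1}(\mathbb F_p)$ into the (discrete) group of upper triangular unipotent $(n+1)\times(n+1)$ matrices over $\mathbb F_p$ whose $(i,i+1)$ entry is $-a_i$ for every $1\le i\le n$. -/

import Mathlib

/-!
Continuous `ℤ/p`-cochains of a topological group in degrees `≤ 3` (inhomogeneous, trivial
coefficients), the cohomology groups `H¹`, `H²`, the cup product, Massey products of classes in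
`H¹`, Demushkin groups, and the embedding problem into the unitriangular group.
-/

namespace DemushkinMassey

section Cochains

variable (p : ℕ) (G : Type*) [Group G] [TopologicalSpace G]

/-- Continuous inhomogeneous `1`-cochains `G → ℤ/p`. -/
abbrev C1 := C(G, ZMod p)

/-- Continuous inhomogeneous `2`-cochains `G × G → ℤ/p`. -/
abbrev C2 := C(G × G, ZMod p)

/-- Continuous inhomogeneous `3`-cochains `G × G × G → ℤ/p`. -/
abbrev C3 := C(G × G × G, ZMod p)

variable [IsTopologicalGroup G]

/-- The differential `C¹ → C²`, `(δ f)(g, h) = f(h) - f(gh) + f(g)`. -/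
def δ₁ : C1 p G →ₗ[ZMod p] C2 p G where
  toFun f :=
    { toFun := fun x => f x.2 - f (x.1 * x.2) + f x.1
      continuous_toFun := by fun_prop }
  map_add' f f' := by ext x; simp; ring
  map_smul' c f := by ext x; simp; ring

/-- The differential `C² → C³`,
`(δ f)(g, h, k) = f(h, k) - f(gh, k) + f(g, hk) - f(g, h)`. -/
def δ₂ : C2 p G →ₗ[ZMod p] C3 p G where
  toFun f :=
    { toFun := fun x => f (x.2.1, x.2.2) - f (x.1 * x.2.1, x.2.2)
        + f (x.1, x.2.1 * x.2.2) - f (x.1, x.2.1)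
      continuous_toFun := by fun_prop }
  map_add' f f' := by ext x; simp; ring
  map_smul' c f := by ext x; simp; ring

theorem δ₂_δ₁ (f : C1 p G) : δ₂ p G (δ₁ p G f) = 0 := by
  ext x
  simp only [δ₁, δ₂, LinearMap.coe_mk, AddHom.coe_mk, ContinuousMap.coe_mk, mul_assoc,
    ContinuousMap.zero_apply]
  ring

/-- `H¹(G, ℤ/p)`: the continuous `1`-cocycles. Since `G` acts trivially on `ℤ/p`, these are the
continuous homomorphisms `G → ℤ/p`, and the only `1`-coboundary is zero. -/
abbrev H1 : Submodule (ZMod p) (C1 p G) := LinearMap.ker (δ₁ p G)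

/-- The continuous `2`-cocycles. -/
abbrev Z2 : Submodule (ZMod p) (C2 p G) := LinearMap.ker (δ₂ p G)

/-- The continuous `2`-coboundaries, as a submodule of the `2`-cocycles. -/
abbrev B2 : Submodule (ZMod p) (Z2 p G) := (LinearMap.range (δ₁ p G)).comap (Z2 p G).subtype

/-- `H²(G, ℤ/p)`: continuous `2`-cocycles modulo continuous `2`-coboundaries. -/
abbrev H2 := Z2 p G ⧸ B2 p G

end Cochains

section Products

variable {p : ℕ} {G : Type*} [Group G] [TopologicalSpace G]

/-- The cup product of `1`-cochains, `(f ∪ f')(g, h) = f(g) f'(h)`. -/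
def cupC (f f' : C1 p G) : C2 p G where
  toFun x := f x.1 * f' x.2
  continuous_toFun := by fun_prop

variable [IsTopologicalGroup G]

theorem mem_H1_iff (f : C1 p G) : f ∈ H1 p G ↔ ∀ g h, f (g * h) = f g + f h := by
  rw [LinearMap.mem_ker, ContinuousMap.ext_iff]
  refine ⟨fun h x y => ?_, fun h x => ?_⟩
  · have h1 : f y - f (x * y) + f x = 0 := h (x, y)
    linear_combination -h1
  · have h1 := h x.1 x.2
    change f x.2 - f (x.1 * x.2) + f x.1 = 0
    linear_combination -h1

/-- Leibniz rule in degree `1`. -/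
theorem δ₂_cupC (f f' : C1 p G) (x y z : G) :
    δ₂ p G (cupC f f') (x, y, z) = δ₁ p G f (x, y) * f' z - f x * δ₁ p G f' (y, z) := by
  simp only [δ₁, δ₂, cupC, LinearMap.coe_mk, AddHom.coe_mk, ContinuousMap.coe_mk]
  ring

theorem cupC_mem_Z2 (a b : H1 p G) : cupC (a : C1 p G) b ∈ Z2 p G := by
  rw [LinearMap.mem_ker]
  ext ⟨x, y, z⟩
  rw [δ₂_cupC, LinearMap.mem_ker.1 a.2, LinearMap.mem_ker.1 b.2]
  simp

variable (p G) in
/-- The cup product `H¹(G, ℤ/p) × H¹(G, ℤ/p) → H²(G, ℤ/p)` as a bilinear map. -/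
def cup : H1 p G →ₗ[ZMod p] H1 p G →ₗ[ZMod p] H2 p G :=
  LinearMap.mk₂ (ZMod p)
    (fun a b => (B2 p G).mkQ ⟨cupC (a : C1 p G) b, cupC_mem_Z2 a b⟩)
    (fun a a' b => by
      rw [← map_add]; congr 1; ext x; simp [cupC, add_mul])
    (fun c a b => by
      rw [← map_smul]; congr 1; ext x; simp [cupC, mul_assoc])
    (fun a b b' => by
      rw [← map_add]; congr 1; ext x; simp [cupC, mul_add])
    (fun c a b => by
      rw [← map_smul]; congr 1; ext x; simp [cupC, mul_left_comm])

/-- A defining system for the `n`-fold Massey product of `a₁, …, aₙ ∈ H¹(G, ℤ/p)`. Rows and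
columns `1, …, n + 1` are indexed by `Fin (n + 1)`; the conditions only involve the entries
`(i, j)` with `i < j` and `(i, j)` different from the top right corner. -/
structure IsDefiningSystem {n : ℕ} (a : Fin n → H1 p G)
    (A : Fin (n + 1) → Fin (n + 1) → C1 p G) : Prop where
  /-- The class `aᵢ` is represented by the entry `(i, i + 1)`. -/
  represents : ∀ i : Fin n, A i.castSucc i.succ = (a i : C1 p G)
  /-- `δ aᵢⱼ = ∑_{i < k < j} aᵢₖ ∪ aₖⱼ`. -/
  delta_eq : ∀ i j : Fin (n + 1), i < j → ¬(i = 0 ∧ j = Fin.last n) →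
    δ₁ p G (A i j) = ∑ k ∈ Finset.Ioo i j, cupC (A i k) (A k j)

/-- The `2`-cochain `∑_{1 < k < n + 1} a₁ₖ ∪ aₖ,ₙ₊₁` attached to a defining system. -/
def masseyCochain {n : ℕ} (A : Fin (n + 1) → Fin (n + 1) → C1 p G) : C2 p G :=
  ∑ k ∈ Finset.Ioo 0 (Fin.last n), cupC (A 0 k) (A k (Fin.last n))

theorem masseyCochain_mem_Z2 {n : ℕ} {a : Fin n → H1 p G}
    {A : Fin (n + 1) → Fin (n + 1) → C1 p G} (hA : IsDefiningSystem a A) :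
    masseyCochain A ∈ Z2 p G := by
  rw [LinearMap.mem_ker]
  ext ⟨x, y, z⟩
  have h1 : ∀ k ∈ Finset.Ioo 0 (Fin.last n),
      δ₂ p G (cupC (A 0 k) (A k (Fin.last n))) (x, y, z)
        = (∑ l ∈ Finset.Ioo 0 k, A 0 l x * A l k y * A k (Fin.last n) z)
          - ∑ l ∈ Finset.Ioo k (Fin.last n), A 0 k x * A k l y * A l (Fin.last n) z := by
    intro k hk
    rw [Finset.mem_Ioo] at hk
    rw [δ₂_cupC, hA.delta_eq 0 k hk.1 (fun h => hk.2.ne h.2),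
      hA.delta_eq k (Fin.last n) hk.2 (fun h => hk.1.ne' h.1)]
    simp [cupC, Finset.sum_mul, Finset.mul_sum, mul_assoc]
  have h2 : δ₂ p G (masseyCochain A) (x, y, z)
      = ∑ k ∈ Finset.Ioo 0 (Fin.last n),
        δ₂ p G (cupC (A 0 k) (A k (Fin.last n))) (x, y, z) := by
    simp [masseyCochain, map_sum]
  rw [h2, Finset.sum_congr rfl h1, Finset.sum_sub_distrib, ContinuousMap.zero_apply, sub_eq_zero]
  refine Finset.sum_comm' fun k l => ?_
  simp only [Finset.mem_Ioo]
  constructor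
  · rintro ⟨⟨h3, h4⟩, h5, h6⟩
    exact ⟨⟨h6, h4⟩, h5, h6.trans h4⟩
  · rintro ⟨⟨h3, h4⟩, h5, h6⟩
    exact ⟨⟨h5.trans h3, h4⟩, h5, h3⟩

/-- The `n`-fold Massey product `⟨a₁, …, aₙ⟩ ⊆ H²(G, ℤ/p)`: the set of classes obtained from all
defining systems. -/
def masseyProduct {n : ℕ} (a : Fin n → H1 p G) : Set (H2 p G) :=
  {c | ∃ (A : Fin (n + 1) → Fin (n + 1) → C1 p G) (hA : IsDefiningSystem a A),
    c = (B2 p G).mkQ ⟨masseyCochain A, masseyCochain_mem_Z2 hA⟩}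

/-- The Massey product `⟨a₁, …, aₙ⟩` vanishes: it contains zero. -/
def MasseyVanishes {n : ℕ} (a : Fin n → H1 p G) : Prop :=
  (0 : H2 p G) ∈ masseyProduct a

/-- `aᵢ ∪ aᵢ₊₁ = 0` for all consecutive indices. -/
def ConsecutiveCupsVanish {n : ℕ} (a : Fin n → H1 p G) : Prop :=
  ∀ i j : Fin n, (i : ℕ) + 1 = j → cup p G (a i) (a j) = 0

end Products

section Properties

variable (p : ℕ) (G : Type*) [Group G] [TopologicalSpace G] [IsTopologicalGroup G]

/-- The strong vanishing `n`-fold Massey product property of `G` with respect to `p`. -/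
def HasStrongMasseyVanishing (n : ℕ) : Prop :=
  ∀ a : Fin n → H1 p G, ConsecutiveCupsVanish a → MasseyVanishes a

/-- A pro-`p` group: a profinite group (compact and totally disconnected topological group) all of
whose open normal subgroups have index a power of `p`. -/
structure IsProPGroup : Prop where
  compactSpace : CompactSpace G
  totallyDisconnectedSpace : TotallyDisconnectedSpace G
  index_eq_pow : ∀ N : OpenNormalSubgroup G, ∃ k : ℕ, (N : Subgroup G).index = p ^ k

/-- A pro-`p` Demushkin group. -/
structure IsDemushkin : Prop where
  isProPGroup : IsProPGroup p G
  finite_H1 : Module.Finite (ZMod p) (H1 p G)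
  finrank_H2 : Module.finrank (ZMod p) (H2 p G) = 1
  cup_nondegenerate : (cup p G).Nondegenerate

end Properties

section Unitriangular

/-- The group `U_m(p)` of upper triangular `m × m` matrices over `ℤ/p` with ones on the
diagonal, as a subgroup of the general linear group. -/
def unitriangular (p m : ℕ) : Subgroup (GL (Fin m) (ZMod p)) where
  carrier := {M | (∀ i, M i i = 1) ∧ ∀ i j, j < i → M i j = 0}
  one_mem' := by
    refine ⟨fun i => by simp, fun i j h => by simp [h.ne']⟩
  mul_mem' := by
    rintro M N ⟨hM1, hM0⟩ ⟨hN1, hN0⟩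
    refine ⟨fun i => ?_, fun i j h => ?_⟩
    · rw [Units.val_mul, Matrix.mul_apply, Finset.sum_eq_single i]
      · rw [hM1, hN1, one_mul]
      · intro k _ hk
        rcases lt_or_gt_of_ne hk with h | h
        · rw [hM0 i k h, zero_mul]
        · rw [hN0 k i h, mul_zero]
      · simp
    · rw [Units.val_mul, Matrix.mul_apply]
      refine Finset.sum_eq_zero fun k _ => ?_
      rcases lt_or_ge k i with hk | hk
      · rw [hM0 i k hk, zero_mul]
      · rw [hN0 k j (h.trans_le hk), mul_zero]
  inv_mem' := by
    rintro M ⟨hM1, hM0⟩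
    have hM : Matrix.BlockTriangular (M : Matrix (Fin m) (Fin m) (ZMod p)) id :=
      fun i j h => hM0 i j h
    have hI : Matrix.BlockTriangular ((M⁻¹ : GL (Fin m) (ZMod p)) :
        Matrix (Fin m) (Fin m) (ZMod p)) id := by
      have : Invertible (M : Matrix (Fin m) (Fin m) (ZMod p)) := M.isUnit.invertible
      rw [Matrix.coe_units_inv]
      exact Matrix.blockTriangular_inv_of_blockTriangular hM
    refine ⟨fun i => ?_, fun i j h => hI h⟩
    have h1 : ((M * M⁻¹ : GL (Fin m) (ZMod p)) : Matrix (Fin m) (Fin m) (ZMod p)) i i = 1 := by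
      simp
    rw [Units.val_mul, Matrix.mul_apply, Finset.sum_eq_single i] at h1
    · rwa [hM1, one_mul] at h1
    · intro k _ hk
      rcases lt_or_gt_of_ne hk with h | h
      · rw [hM0 i k h, zero_mul]
      · rw [hI h, mul_zero]
    · simp

/-- The topology on `U_m(p)` coming from the general linear group is discrete. -/
instance (p m : ℕ) : DiscreteTopology (unitriangular p m) := by
  have : DiscreteTopology (Matrix (Fin m) (Fin m) (ZMod p)) :=
    inferInstanceAs (DiscreteTopology (Fin m → Fin m → ZMod p))
  have h : DiscreteTopology (GL (Fin m) (ZMod p)) :=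
    DiscreteTopology.of_continuous_injective Units.continuous_val Units.val_injective
  infer_instance

variable {p : ℕ} {G : Type*} [Group G] [TopologicalSpace G] [IsTopologicalGroup G]

/-- The embedding problem given by the homomorphism
`-a₁ × ⋯ × -aₙ : G → (ℤ/p)ⁿ` and the surjection `U_{n+1}(p) → (ℤ/p)ⁿ`,
`U ↦ (e₁₂(U), …, e_{n,n+1}(U))`, has a solution: a continuous homomorphism `ψ : G → U_{n+1}(p)`
whose `(i, i + 1)` entries are the `-aᵢ`. -/
def EmbeddingProblemSolvable {n : ℕ} (a : Fin n → H1 p G) : Prop :=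
  ∃ ψ : G →ₜ* unitriangular p (n + 1), ∀ (g : G) (i : Fin n),
    (ψ g : GL (Fin (n + 1)) (ZMod p)) i.castSucc i.succ = -((a i : C1 p G) g)

end Unitriangular

end DemushkinMassey

namespace DemushkinMassey

/-! ### Bilinearity of the cup product on cochains -/

section CupC

variable {p : ℕ} {G : Type*} [TopologicalSpace G]

/-! One constructs a solution of the defining equations in every position, the top right corner
included. It is built column by column, each column from the bottom up. The obstruction to filling
row `i` is the class of a cocycle. When `aᵢ ≠ 0`, nondegeneracy and `dim H² = 1` make `aᵢ ∪ -`
surjective onto `H²`, so this class is killed by adding a homomorphism to the entry just below. No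
equation already solved changes.

Two cases escape this. Next to the bottom, the entry below is prescribed, but the obstruction is a
consecutive cup product, zero by hypothesis. If some class between row and column is zero, the entry
is set to zero; keeping the system block diagonal makes the right-hand side vanish. The induction
step is `IsDemushkin.exists_isColumn_of_succ`.

The corner entry bounds the Massey cochain, and the negated entries form the unipotent
representation (`unipotentMatrix_mul`). -/

theorem cupC_add_right (f g h : C1 p G) : cupC f (g + h) = cupC f g + cupC f h := by
  ext x
  simp [cupC, mul_add]

theorem cupC_zero_right (f : C1 p G) : cupC f 0 = 0 := by
  ext x
  simp [cupC]

theorem cupC_zero_left (f : C1 p G) : cupC 0 f = 0 := by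
  ext x
  simp [cupC]

end CupC

/-! ### Full defining systems over a Demushkin group -/

section Systems

variable {p : ℕ} {G : Type*} [Group G] [TopologicalSpace G] [IsTopologicalGroup G]

/-- The product of a row `r` and a column `c` which are compatible with a matrix `A` of cochains
is a cocycle. -/
theorem sum_cupC_mem_Z2 (A : ℕ → ℕ → C1 p G) (r c : ℕ → C1 p G) (i j : ℕ)
    (hr : ∀ k ∈ Finset.Ioo i j, δ₁ p G (r k) = ∑ l ∈ Finset.Ioo i k, cupC (r l) (A l k))
    (hc : ∀ k ∈ Finset.Ioo i j, δ₁ p G (c k) = ∑ l ∈ Finset.Ioo k j, cupC (A k l) (c l)) :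
    ∑ k ∈ Finset.Ioo i j, cupC (r k) (c k) ∈ Z2 p G := by
  rw [LinearMap.mem_ker]
  ext ⟨x, y, z⟩
  have h1 : ∀ k ∈ Finset.Ioo i j, δ₂ p G (cupC (r k) (c k)) (x, y, z)
      = (∑ l ∈ Finset.Ioo i k, r l x * A l k y * c k z)
        - ∑ l ∈ Finset.Ioo k j, r k x * A k l y * c l z := by
    intro k hk
    rw [δ₂_cupC, hr k hk, hc k hk]
    simp [cupC, Finset.sum_mul, Finset.mul_sum, mul_assoc]
  have h2 : δ₂ p G (∑ k ∈ Finset.Ioo i j, cupC (r k) (c k)) (x, y, z)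
      = ∑ k ∈ Finset.Ioo i j, δ₂ p G (cupC (r k) (c k)) (x, y, z) := by
    simp [map_sum]
  rw [h2, Finset.sum_congr rfl h1, Finset.sum_sub_distrib, ContinuousMap.zero_apply, sub_eq_zero]
  -- Both double sums run over the pairs of indices `i < l < k < j`, in opposite orders.
  refine Finset.sum_comm' fun k l => ?_
  simp only [Finset.mem_Ioo]
  omega

theorem mkQ_B2_eq_zero_iff (z : Z2 p G) :
    (B2 p G).mkQ z = 0 ↔ ∃ f : C1 p G, δ₁ p G f = z := by
  rw [Submodule.mkQ_apply, Submodule.Quotient.mk_eq_zero]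
  simp

theorem cup_eq_zero_iff (a b : H1 p G) :
    cup p G a b = 0 ↔ ∃ f : C1 p G, δ₁ p G f = cupC (a : C1 p G) b :=
  mkQ_B2_eq_zero_iff ⟨cupC (a : C1 p G) b, cupC_mem_Z2 a b⟩

/-- In a Demushkin group, cup product with a nonzero class is onto `H²`. -/
theorem IsDemushkin.cup_surjective [Fact p.Prime] (hG : IsDemushkin p G) {a : H1 p G}
    (ha : a ≠ 0) : Function.Surjective (cup p G a) := by
  obtain ⟨x, hx⟩ : ∃ x, cup p G a x ≠ 0 := by
    by_contra! h
    exact ha (hG.cup_nondegenerate.1 a h)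
  intro z
  obtain ⟨c, hc⟩ := (finrank_eq_one_iff_of_nonzero' _ hx).1 hG.finrank_H2 z
  exact ⟨c • x, by rw [map_smul, hc]⟩

/-- Over a Demushkin group, every cocycle becomes a coboundary after adding a suitable multiple
of a given nonzero class. -/
theorem IsDemushkin.exists_delta_eq_add [Fact p.Prime] (hG : IsDemushkin p G) {a : H1 p G}
    (ha : a ≠ 0) {z : C2 p G} (hz : z ∈ Z2 p G) :
    ∃ (x : H1 p G) (f : C1 p G), δ₁ p G f = z + cupC (a : C1 p G) x := by
  -- The correction is chosen to cancel the class of `z`.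
  obtain ⟨x, hx⟩ := hG.cup_surjective ha (-(B2 p G).mkQ ⟨z, hz⟩)
  have h : (B2 p G).mkQ (⟨z, hz⟩ + ⟨cupC (a : C1 p G) x, cupC_mem_Z2 a x⟩) = 0 := by
    rw [map_add]
    exact add_eq_zero_iff_neg_eq.2 hx.symm
  obtain ⟨f, hf⟩ := (mkQ_B2_eq_zero_iff _).1 h
  exact ⟨x, f, hf⟩

/-- A solution, in the columns up to `N`, of the equations of a full defining system for the
sequence `a`, which is block diagonal with respect to the zeros of `a`. -/
structure IsFullSystem (a : ℕ → H1 p G) (N : ℕ) (A : ℕ → ℕ → C1 p G) : Prop where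
  represents : ∀ i < N, A i (i + 1) = (a i : C1 p G)
  delta_eq : ∀ i j, i < j → j ≤ N →
    δ₁ p G (A i j) = ∑ k ∈ Finset.Ioo i j, cupC (A i k) (A k j)
  eq_zero : ∀ i j l, j ≤ N → i ≤ l → l < j → a l = 0 → A i j = 0

/-- The rows from `i` on of a column `N + 1` extending a full system. -/
structure IsColumn (a : ℕ → H1 p G) (N : ℕ) (A : ℕ → ℕ → C1 p G) (i : ℕ) (c : ℕ → C1 p G) :
    Prop where
  represents : c N = (a N : C1 p G)
  delta_eq : ∀ k, i ≤ k → k < N + 1 →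
    δ₁ p G (c k) = ∑ l ∈ Finset.Ioo k (N + 1), cupC (A k l) (c l)
  eq_zero : ∀ k l, i ≤ k → k ≤ l → l < N + 1 → a l = 0 → c k = 0

theorem IsColumn.update {a : ℕ → H1 p G} {N : ℕ} {A : ℕ → ℕ → C1 p G} {i : ℕ}
    {c : ℕ → C1 p G} (hc : IsColumn a N A (i + 1) c) (hi : i < N) {f : C1 p G}
    (hf : δ₁ p G f = ∑ l ∈ Finset.Ioo i (N + 1), cupC (A i l) (c l))
    (hf0 : ∀ l, i ≤ l → l < N + 1 → a l = 0 → f = 0) :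
    IsColumn a N A i (Function.update c i f) where
  represents := by rw [Function.update_of_ne hi.ne', hc.represents]
  delta_eq k hk hkN := by
    have hs : ∑ l ∈ Finset.Ioo k (N + 1), cupC (A k l) (Function.update c i f l)
        = ∑ l ∈ Finset.Ioo k (N + 1), cupC (A k l) (c l) := by
      refine Finset.sum_congr rfl fun l hl => ?_
      rw [Function.update_of_ne (hk.trans_lt (Finset.mem_Ioo.1 hl).1).ne']
    rw [hs]
    rcases hk.eq_or_lt with rfl | hk
    · rw [Function.update_self, hf]
    · rw [Function.update_of_ne hk.ne', hc.delta_eq k hk hkN]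
  eq_zero k l hk hkl hlN hl := by
    rcases hk.eq_or_lt with rfl | hk
    · rw [Function.update_self, hf0 l hkl hlN hl]
    · rw [Function.update_of_ne hk.ne', hc.eq_zero k l hk hkl hlN hl]

/-- The top entry occurs in the equations of the column only through its coboundary, which a cocycle
does not change. The bottom entry is prescribed, hence `i < N`; block diagonality imposes nothing
when the classes involved are nonzero. -/
theorem IsColumn.add {a : ℕ → H1 p G} {N : ℕ} {A : ℕ → ℕ → C1 p G} {i : ℕ}
    {c : ℕ → C1 p G} (hc : IsColumn a N A i c) (hi : i < N)
    (ha : ∀ l, i ≤ l → l < N + 1 → a l ≠ 0) (x : H1 p G) :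
    IsColumn a N A i (Function.update c i (c i + x)) where
  represents := by rw [Function.update_of_ne hi.ne', hc.represents]
  delta_eq k hk hkN := by
    have hs : ∑ l ∈ Finset.Ioo k (N + 1), cupC (A k l) (Function.update c i (c i + x) l)
        = ∑ l ∈ Finset.Ioo k (N + 1), cupC (A k l) (c l) := by
      refine Finset.sum_congr rfl fun l hl => ?_
      rw [Function.update_of_ne (hk.trans_lt (Finset.mem_Ioo.1 hl).1).ne']
    rw [hs, ← hc.delta_eq k hk hkN]
    rcases hk.eq_or_lt with rfl | hk
    · rw [Function.update_self, map_add, LinearMap.mem_ker.1 x.2, add_zero]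
    · rw [Function.update_of_ne hk.ne']
  eq_zero k l hk hkl hlN hl := (ha l (hk.trans hkl) hlN hl).elim

theorem IsDemushkin.exists_isColumn_of_succ [Fact p.Prime] (hG : IsDemushkin p G)
    {a : ℕ → H1 p G} (ha : ∀ i, cup p G (a i) (a (i + 1)) = 0) {N : ℕ} {A : ℕ → ℕ → C1 p G}
    (hA : IsFullSystem a N A) {i : ℕ} (hi : i < N) {c : ℕ → C1 p G}
    (hc : IsColumn a N A (i + 1) c) : ∃ c', IsColumn a N A i c' := by
  by_cases h0 : ∃ l, i ≤ l ∧ l < N + 1 ∧ a l = 0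
  · obtain ⟨l, hil, hlN, hl⟩ := h0
    refine ⟨_, hc.update hi (f := 0) ?_ fun _ _ _ _ => rfl⟩
    rw [map_zero, eq_comm]
    refine Finset.sum_eq_zero fun k hk => ?_
    rw [Finset.mem_Ioo] at hk
    -- The zero class `a l` lies in the range of one factor of each term: of `A i k` if `l < k`, of
    -- `c k` if `k ≤ l`.
    rcases lt_or_ge l k with hlk | hkl
    · rw [hA.eq_zero i k l (by omega) hil hlk hl, cupC_zero_left]
    · rw [hc.eq_zero k l hk.1 hkl hlN hl, cupC_zero_right]
  push Not at h0
  rcases Nat.lt_or_ge (i + 1) N with hiN | hiN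
  · have hz : ∑ k ∈ Finset.Ioo i (N + 1), cupC (A i k) (c k) ∈ Z2 p G := by
      refine sum_cupC_mem_Z2 A _ _ i (N + 1) (fun k hk => ?_) fun k hk => ?_
      · rw [Finset.mem_Ioo] at hk
        exact hA.delta_eq i k hk.1 (by omega)
      · rw [Finset.mem_Ioo] at hk
        exact hc.delta_eq k hk.1 hk.2
    obtain ⟨x, f, hf⟩ := hG.exists_delta_eq_add (h0 i le_rfl (by omega)) hz
    refine ⟨_, (hc.add hiN (fun l hl => h0 l (by omega)) x).update hi (f := f) ?_
      fun l hil hlN hl => (h0 l hil hlN hl).elim⟩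
    -- Only the term of index `i + 1` feels the correction, and its left factor is `A i (i + 1) = a
    -- i`, so the sum gains exactly `a i ∪ x`.
    have hm : i + 1 ∈ Finset.Ioo i (N + 1) := Finset.mem_Ioo.2 ⟨by omega, by omega⟩
    rw [hf, ← Finset.add_sum_erase _ _ hm, ← Finset.add_sum_erase _ _ hm, Function.update_self,
      cupC_add_right, hA.represents i hi, add_right_comm]
    congr 1
    refine Finset.sum_congr rfl fun l hl => ?_
    rw [Function.update_of_ne (Finset.ne_of_mem_erase hl)]
  · obtain rfl : N = i + 1 := by omega
    obtain ⟨f, hf⟩ := (cup_eq_zero_iff _ _).1 (ha i)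
    refine ⟨_, hc.update hi (f := f) ?_ fun l hil hlN hl => (h0 l hil hlN hl).elim⟩
    have hI : Finset.Ioo i (i + 1 + 1) = {i + 1} := by
      ext k
      simp only [Finset.mem_Ioo, Finset.mem_singleton]
      omega
    rw [hf, hI, Finset.sum_singleton, hA.represents i hi, hc.represents]

theorem IsDemushkin.exists_isColumn [Fact p.Prime] (hG : IsDemushkin p G)
    {a : ℕ → H1 p G} (ha : ∀ i, cup p G (a i) (a (i + 1)) = 0) {N : ℕ} {A : ℕ → ℕ → C1 p G}
    (hA : IsFullSystem a N A) : ∃ c, IsColumn a N A 0 c := by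
  refine Nat.decreasingInduction' (P := fun i => ∃ c, IsColumn a N A i c)
    (fun i hi _ ⟨c, hc⟩ => hG.exists_isColumn_of_succ ha hA hi hc) (Nat.zero_le N)
    -- Only row `N` is constrained at the start, so the values elsewhere are arbitrary.
    ⟨fun _ => a N, rfl, fun k hk hkN => ?_, fun k l hk hkl hlN hl => ?_⟩
  · obtain rfl : k = N := by omega
    rw [LinearMap.mem_ker.1 (a k).2, eq_comm]
    refine Finset.sum_eq_zero fun l hl => ?_
    rw [Finset.mem_Ioo] at hl
    omega
  · obtain rfl : l = N := by omega
    rw [hl]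
    rfl

theorem IsFullSystem.succ {a : ℕ → H1 p G} {N : ℕ} {A : ℕ → ℕ → C1 p G}
    (hA : IsFullSystem a N A) {c : ℕ → C1 p G} (hc : IsColumn a N A 0 c) :
    IsFullSystem a (N + 1) fun i j => if j = N + 1 then c i else A i j where
  represents i hi := by
    rcases eq_or_ne i N with rfl | hiN
    · simpa using hc.represents
    · simpa [hiN] using hA.represents i (by omega)
  delta_eq i j hij hj := by
    have hs : ∀ k ∈ Finset.Ioo i j, k ≠ N + 1 := fun k hk => by
      rw [Finset.mem_Ioo] at hk
      omega
    rcases eq_or_ne j (N + 1) with rfl | hjN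
    · simp only [if_true]
      rw [hc.delta_eq i (Nat.zero_le i) hij]
      exact Finset.sum_congr rfl fun k hk => by rw [if_neg (hs k hk)]
    · simp only [if_neg hjN]
      rw [hA.delta_eq i j hij (by omega)]
      exact Finset.sum_congr rfl fun k hk => by rw [if_neg (hs k hk)]
  eq_zero i j l hj hil hlj hl := by
    rcases eq_or_ne j (N + 1) with rfl | hjN
    · simpa using hc.eq_zero i l (Nat.zero_le i) hil hlj hl
    · simpa [hjN] using hA.eq_zero i j l (by omega) hil hlj hl

theorem IsDemushkin.exists_isFullSystem [Fact p.Prime] (hG : IsDemushkin p G)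
    {a : ℕ → H1 p G} (ha : ∀ i, cup p G (a i) (a (i + 1)) = 0) (N : ℕ) :
    ∃ A, IsFullSystem a N A := by
  induction N with
  | zero =>
    exact ⟨0, fun i hi => by omega, fun i j hij hj => by omega, fun _ _ _ _ _ _ _ => rfl⟩
  | succ N ih =>
    obtain ⟨A, hA⟩ := ih
    obtain ⟨c, hc⟩ := hG.exists_isColumn ha hA
    exact ⟨_, hA.succ hc⟩

/-- Over a Demushkin group, classes with vanishing consecutive cup products admit a defining
system whose equations also hold in the top right corner. -/
theorem IsDemushkin.exists_system [Fact p.Prime] (hG : IsDemushkin p G) {n : ℕ}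
    {a : Fin n → H1 p G} (ha : ConsecutiveCupsVanish a) :
    ∃ A : Fin (n + 1) → Fin (n + 1) → C1 p G,
      (∀ i : Fin n, A i.castSucc i.succ = (a i : C1 p G)) ∧
      ∀ i j, i < j → δ₁ p G (A i j) = ∑ k ∈ Finset.Ioo i j, cupC (A i k) (A k j) := by
  -- Extension by zero keeps all consecutive cup products zero.
  let b : ℕ → H1 p G := fun i => if h : i < n then a ⟨i, h⟩ else 0
  have hb : ∀ i, cup p G (b i) (b (i + 1)) = 0 := by
    intro i
    by_cases h : i + 1 < n
    · simp only [b, dif_pos h, dif_pos (Nat.lt_of_succ_lt h)]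
      exact ha _ _ rfl
    · simp only [b, dif_neg h, map_zero]
  obtain ⟨A, hA⟩ := hG.exists_isFullSystem hb n
  refine ⟨fun i j => A i j, fun i => ?_, fun i j hij => ?_⟩
  · simpa [b] using hA.represents i i.2
  · rw [hA.delta_eq i j hij (Nat.le_of_lt_succ j.2), ← Fin.map_valEmbedding_Ioo, Finset.sum_map]
    rfl

end Systems

/-! ### From full systems to unipotent representations -/

section Representation

variable {p : ℕ} {G : Type*} [TopologicalSpace G] {n : ℕ}

/-- The upper unitriangular matrix with entries `-Aᵢⱼ(g)` above the diagonal. -/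
def unipotentMatrix (A : Fin n → Fin n → C1 p G) (g : G) : Matrix (Fin n) (Fin n) (ZMod p) :=
  Matrix.of fun i j => if i < j then -A i j g else if i = j then 1 else 0

theorem unipotentMatrix_apply_self (A : Fin n → Fin n → C1 p G) (g : G) (i : Fin n) :
    unipotentMatrix A g i i = 1 := by
  simp [unipotentMatrix]

theorem unipotentMatrix_apply_of_lt (A : Fin n → Fin n → C1 p G) (g : G) {i j : Fin n}
    (h : i < j) : unipotentMatrix A g i j = -A i j g := by
  simp [unipotentMatrix, h]

theorem unipotentMatrix_apply_of_gt (A : Fin n → Fin n → C1 p G) (g : G) {i j : Fin n}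
    (h : j < i) : unipotentMatrix A g i j = 0 := by
  simp [unipotentMatrix, h.not_gt, h.ne']

theorem isUnit_unipotentMatrix (A : Fin n → Fin n → C1 p G) (g : G) :
    IsUnit (unipotentMatrix A g) := by
  have hT : (unipotentMatrix A g).BlockTriangular id := fun i j h =>
    unipotentMatrix_apply_of_gt A g h
  rw [Matrix.isUnit_iff_isUnit_det, Matrix.det_of_isUpperTriangular hT]
  simp [unipotentMatrix_apply_self]

theorem continuous_unipotentMatrix (A : Fin n → Fin n → C1 p G) :
    Continuous (unipotentMatrix A) := by
  refine continuous_matrix fun i j => ?_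
  simp only [unipotentMatrix, Matrix.of_apply]
  split_ifs <;> fun_prop

variable [Group G] [IsTopologicalGroup G]

/-- Above the diagonal, the equation for `δ aᵢⱼ` is matrix multiplication: the terms `k = i` and `k
= j` give `-aᵢⱼ(h) - aᵢⱼ(g)`, and the signs cancel in the other products. -/
theorem unipotentMatrix_mul {A : Fin n → Fin n → C1 p G}
    (hA : ∀ i j, i < j → δ₁ p G (A i j) = ∑ k ∈ Finset.Ioo i j, cupC (A i k) (A k j)) (g h : G) :
    unipotentMatrix A (g * h) = unipotentMatrix A g * unipotentMatrix A h := by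
  ext i j
  rw [Matrix.mul_apply]
  have hsub : ∑ k, unipotentMatrix A g i k * unipotentMatrix A h k j
      = ∑ k ∈ Finset.Icc i j, unipotentMatrix A g i k * unipotentMatrix A h k j := by
    refine (Finset.sum_subset (Finset.subset_univ _) fun k _ hk => ?_).symm
    rw [Finset.mem_Icc, not_and_or, not_le, not_le] at hk
    rcases hk with hk | hk
    · rw [unipotentMatrix_apply_of_gt A g hk, zero_mul]
    · rw [unipotentMatrix_apply_of_gt A h hk, mul_zero]
  rw [hsub]
  rcases lt_trichotomy i j with hij | rfl | hij
  · have hd : A i j h - A i j (g * h) + A i j g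
        = ∑ k ∈ Finset.Ioo i j, A i k g * A k j h := by
      have := congrArg (fun f : C2 p G => f (g, h)) (hA i j hij)
      simpa [δ₁, cupC] using this
    have hs : ∑ k ∈ Finset.Ioo i j, unipotentMatrix A g i k * unipotentMatrix A h k j
        = ∑ k ∈ Finset.Ioo i j, A i k g * A k j h := by
      refine Finset.sum_congr rfl fun k hk => ?_
      rw [Finset.mem_Ioo] at hk
      rw [unipotentMatrix_apply_of_lt A g hk.1, unipotentMatrix_apply_of_lt A h hk.2, neg_mul_neg]
    rw [← Finset.Ioc_insert_left hij.le, Finset.sum_insert Finset.left_notMem_Ioc,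
      ← Finset.Ioo_insert_right hij, Finset.sum_insert Finset.right_notMem_Ioo, hs, ← hd]
    simp only [unipotentMatrix_apply_self, unipotentMatrix_apply_of_lt A _ hij]
    ring
  · simp [unipotentMatrix_apply_self]
  · rw [Finset.Icc_eq_empty hij.not_ge, Finset.sum_empty, unipotentMatrix_apply_of_gt A _ hij]

/-- The homomorphism to the unitriangular group given by a solution of the equations
`δ aᵢⱼ = ∑ aᵢₖ ∪ aₖⱼ` for all `i < j`. -/
noncomputable def unipotentHom {A : Fin n → Fin n → C1 p G}
    (hA : ∀ i j, i < j → δ₁ p G (A i j) = ∑ k ∈ Finset.Ioo i j, cupC (A i k) (A k j)) :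
    G →ₜ* unitriangular p n where
  toMonoidHom := MonoidHom.mk' (fun g => ⟨(isUnit_unipotentMatrix A g).unit,
      unipotentMatrix_apply_self A g, fun _ _ h => unipotentMatrix_apply_of_gt A g h⟩)
    fun g h => Subtype.ext <| Units.ext <| unipotentMatrix_mul hA g h
  continuous_toFun := by
    have hd : DiscreteTopology (Matrix (Fin n) (Fin n) (ZMod p)) :=
      inferInstanceAs (DiscreteTopology (Fin n → Fin n → ZMod p))
    have hv : Function.Injective
        fun M : unitriangular p n => ((M : GL (Fin n) (ZMod p)) : Matrix (Fin n) (Fin n) (ZMod p)) :=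
      Units.val_injective.comp Subtype.val_injective
    have hi : Topology.IsInducing
        fun M : unitriangular p n => ((M : GL (Fin n) (ZMod p)) : Matrix (Fin n) (Fin n) (ZMod p)) :=
      -- The topology induced by an injection into a discrete space is discrete, so continuity can
      -- be tested on matrix entries.
      ⟨by rw [DiscreteTopology.eq_bot (α := unitriangular p n)]
          exact (@DiscreteTopology.of_continuous_injective _ _ (TopologicalSpace.induced _ _) _ hd _
            continuous_induced_dom hv).eq_bot.symm⟩
    exact hi.continuous_iff.2 (continuous_unipotentMatrix A)

end Representation

end DemushkinMassey

theorem theorem3p5 (p : ℕ) [Fact p.Prime] (n : ℕ) (hn : 3 ≤ n)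
    (G : Type*) [Group G] [TopologicalSpace G] [IsTopologicalGroup G]
    (hG : DemushkinMassey.IsDemushkin p G) :
    DemushkinMassey.HasStrongMasseyVanishing p G n ∧
      ∀ a : Fin n → DemushkinMassey.H1 p G, DemushkinMassey.ConsecutiveCupsVanish a →
        DemushkinMassey.EmbeddingProblemSolvable a := by
  refine ⟨fun a ha => ?_, fun a ha => ?_⟩
  · obtain ⟨A, hr, hA⟩ := hG.exists_system ha
    refine ⟨A, ⟨hr, fun i j hij _ => hA i j hij⟩, Eq.symm ?_⟩
    have h0 : (0 : Fin (n + 1)) < Fin.last n := by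
      rw [Fin.lt_def, Fin.val_zero, Fin.val_last]
      omega
    -- The corner equation says that the Massey cochain is a coboundary.
    exact (DemushkinMassey.mkQ_B2_eq_zero_iff _).2 ⟨A 0 (Fin.last n), hA _ _ h0⟩
  · obtain ⟨A, hr, hA⟩ := hG.exists_system ha
    refine ⟨DemushkinMassey.unipotentHom hA, fun g i => ?_⟩
    rw [← hr i]
    exact DemushkinMassey.unipotentMatrix_apply_of_lt A g (Fin.castSucc_lt_succ (i := i))
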